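/- **Conventions.** Let $\mathcal A$ be a category with finite limits and a zero object; $f\cdot g$ denotes "first $f$, then $g$". An internal groupoid $\mathbb A$ in $\mathcal A$ has object of objects $A_0$, object of arrows $A_1$, domain and codomain $d,c\colon A_1\to A_0$, identities $e\colon A_0\to A_1$, composition $m\colon A_1\times_{c,d}A_1\to A_1$ and inverses $i\colon A_1\to A_1$, subject to the groupoid axioms. An internal functor $F\colon\mathbb A\to\mathbb B$ is a pair $F_0\colon A_0\to B_0$, $F_1\colon A_1\to B_1$ compatible with this structure. $\mathrm{Arr}(\mathcal A)$ is the category of arrows $a\colon A\to A_0$ of $\mathcal A$ and commutative squares $(f,f_0)\colon a\to b$ (with $b\colon B\to B_0$ and $a\cdot f_0=f\cdot b$). The normalization functor $\mathcal N\colon\mathrm{Grpd}(\mathcal A)\to\mathrm{Arr}(\mathcal A)$ sends $\mathbb A$ to $k_d\cdot c\colon \mathrm{Ker}(d)\to A_1\to A_0$ and $F$ to $(K_d(F),F_0)$, where $K_d(F)\colon\mathrm{Ker}(d)\to\mathrm{Ker}(d)$ is the morphism with $K_d(F)\cdot k_d=k_d\cdot F_1$. A functor $F$ is *faithful*, *fully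 faithful*, *full* if $\langle d,F_1,c\rangle\colon A_1\to A_0\times_{F_0,d}B_1\times_{c,F_0}A_0$ is, respectively, a monomorphism, an isomorphism, a regular epimorphism; it is *essentially surjective* if $A_0\times_{F_0,d}B_1\to B_1\xrightarrow{\,c\,}B_0$ is a regular epimorphism; it is a *fibration* if $\langle d,F_1\rangle\colon A_1\to A_0\times_{F_0,d}B_1$ is a regular epimorphism. A morphism $(f,f_0)\colon a\to b$ of $\mathrm{Arr}(\mathcal A)$ is *faithful*, *fully faithful*, *full* if $\langle a,f\rangle\colon A\to A_0\times_{f_0,b}B$ is, respectively, a monomorphism, an isomorphism, a regular epimorphism; it is *essentially surjective* if $f_0$ and $b$ are jointly strongly epimorphic; it is a *fibration* if $f$ is a regular epimorphism. (Full functors, essentially surjective functors and fibrations in $\mathrm{Grpd}(\mathcal A)$, and full morphisms and fibrations in $\mathrm{Arr}(\mathcal A)$, are considered only when $\mathcal A$ is regular.) $\mathcal A$ is *protomodular* if all change-of-base functors of its fibration of points reflect isomorphisms. **Proposition.** Let $\mathcal A$ be a finitely complete pointed category and $F\colon\mathbb A\to\mathbb B$ a functor between groupoids in $\mathcal A$.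 1. If $F$ is faithful, then $\mathcal N(F)$ is faithful. 2. If $F$ is fully faithful, then $\mathcal N(F)$ is fully faithful. 3. If $\mathcal A$ is regular and $F$ is full, then $\mathcal N(F)$ is full. 4. If $\mathcal A$ is protomodular and $\mathcal N(F)$ is faithful, then $F$ is faithful. 5. If $\mathcal A$ is protomodular and $\mathcal N(F)$ is fully faithful, then $F$ is fully faithful. 6. If $\mathcal A$ is regular and protomodular and $\mathcal N(F)$ is full, then $F$ is full. 7. If $\mathcal A$ is regular and protomodular and $F$ is essentially surjective, then $\mathcal N(F)$ is essentially surjective. 8. If $\mathcal A$ is regular and $\mathcal N(F)$ is essentially surjective, then $F$ is essentially surjective. 9. If $\mathcal A$ is regular and $F$ is a fibration, then $\mathcal N(F)$ is a fibration. 10. If $\mathcal A$ is regular and protomodular and $\mathcal N(F)$ is a fibration, then $F$ is a fibration. -/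

import Mathlib

open CategoryTheory CategoryTheory.Limits

universe v u

/-- A groupoid internal to a category with pullbacks. Composition `m` is written in diagrammatic
order: `m` is defined on pairs `(f, g)` with `c f = d g`. -/
structure InternalGroupoid (C : Type u) [Category.{v} C] [HasPullbacks C] where
  /-- the object of objects -/
  X₀ : C
  /-- the object of arrows -/
  X₁ : C
  /-- domain -/
  d : X₁ ⟶ X₀
  /-- codomain -/
  c : X₁ ⟶ X₀
  /-- identities -/
  e : X₀ ⟶ X₁
  /-- composition -/
  m : pullback c d ⟶ X₁
  /-- inverses -/
  i : X₁ ⟶ X₁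
  e_d : e ≫ d = 𝟙 X₀
  e_c : e ≫ c = 𝟙 X₀
  m_d : m ≫ d = pullback.fst c d ≫ d
  m_c : m ≫ c = pullback.snd c d ≫ c
  id_m : pullback.lift (d ≫ e) (𝟙 X₁) (by rw [Category.assoc, e_c, Category.comp_id,
    Category.id_comp]) ≫ m = 𝟙 X₁
  m_id : pullback.lift (𝟙 X₁) (c ≫ e) (by rw [Category.assoc, e_d, Category.comp_id,
    Category.id_comp]) ≫ m = 𝟙 X₁
  /-- associativity, stated for composable triples of generalized elements of `X₁` -/
  assoc : ∀ {T : C} (f g h : T ⟶ X₁) (hfg : f ≫ c = g ≫ d) (hgh : g ≫ c = h ≫ d),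
    pullback.lift (pullback.lift f g hfg ≫ m) h
        (by rw [Category.assoc, m_c, pullback.lift_snd_assoc, hgh]) ≫ m =
      pullback.lift f (pullback.lift g h hgh ≫ m)
        (by rw [Category.assoc, m_d, pullback.lift_fst_assoc, hfg]) ≫ m
  i_d : i ≫ d = c
  i_c : i ≫ c = d
  m_i : pullback.lift (𝟙 X₁) i (by rw [i_d, Category.id_comp]) ≫ m = d ≫ e
  i_m : pullback.lift i (𝟙 X₁) (by rw [i_c, Category.id_comp]) ≫ m = c ≫ e

namespace InternalGroupoid

section

variable {C : Type u} [Category.{v} C] [HasPullbacks C]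

/-- An internal functor between internal groupoids. -/
@[ext]
structure Hom (A B : InternalGroupoid C) where
  /-- the action on objects -/
  F₀ : A.X₀ ⟶ B.X₀
  /-- the action on arrows -/
  F₁ : A.X₁ ⟶ B.X₁
  comm_d : F₁ ≫ B.d = A.d ≫ F₀
  comm_c : F₁ ≫ B.c = A.c ≫ F₀
  comm_e : A.e ≫ F₁ = F₀ ≫ B.e
  comm_m : A.m ≫ F₁ =
    pullback.lift (pullback.fst A.c A.d ≫ F₁) (pullback.snd A.c A.d ≫ F₁)
      (by rw [Category.assoc, Category.assoc, comm_c, comm_d, pullback.condition_assoc]) ≫ B.m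

/-- The identity internal functor. -/
def Hom.id (A : InternalGroupoid C) : Hom A A where
  F₀ := 𝟙 _
  F₁ := 𝟙 _
  comm_d := by simp
  comm_c := by simp
  comm_e := by simp
  comm_m := by
    rw [Category.comp_id]
    conv_lhs => rw [← Category.id_comp A.m]
    congr 1
    apply pullback.hom_ext <;> simp

/-- Composition of internal functors. -/
def Hom.comp {A B D : InternalGroupoid C} (F : Hom A B) (G : Hom B D) : Hom A D where
  F₀ := F.F₀ ≫ G.F₀
  F₁ := F.F₁ ≫ G.F₁
  comm_d := by rw [Category.assoc, G.comm_d, ← Category.assoc, F.comm_d, Category.assoc]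
  comm_c := by rw [Category.assoc, G.comm_c, ← Category.assoc, F.comm_c, Category.assoc]
  comm_e := by rw [← Category.assoc, F.comm_e, Category.assoc, G.comm_e, Category.assoc]
  comm_m := by
    rw [← Category.assoc, F.comm_m, Category.assoc, G.comm_m, ← Category.assoc]
    congr 1
    apply pullback.hom_ext <;>
      simp [pullback.lift_fst, pullback.lift_snd, pullback.lift_fst_assoc, pullback.lift_snd_assoc]

/-- The category `Grpd(C)` of internal groupoids and internal functors. -/
instance : Category (InternalGroupoid C) where
  Hom := Hom
  id := Hom.id
  comp := Hom.comp
  id_comp _ := Hom.ext (Category.id_comp _) (Category.id_comp _)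
  comp_id _ := Hom.ext (Category.comp_id _) (Category.comp_id _)
  assoc _ _ _ := Hom.ext (Category.assoc _ _ _) (Category.assoc _ _ _)

variable {A B : InternalGroupoid C}

/-- The limit `A₀ ×_{F₀,d} B₁ ×_{c,F₀} A₀`, as an iterated pullback. -/
noncomputable abbrev homObj (F : A ⟶ B) : C :=
  pullback (pullback.snd F.F₀ B.d ≫ B.c) F.F₀

/-- The comparison `∂(F)₀ = ⟨d, F₁, c⟩ : A₁ ⟶ A₀ ×_{F₀,d} B₁ ×_{c,F₀} A₀`. -/
noncomputable def partialMap (F : A ⟶ B) : A.X₁ ⟶ homObj F :=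
  pullback.lift (pullback.lift A.d F.F₁ F.comm_d.symm) A.c
    (by rw [pullback.lift_snd_assoc, F.comm_c])

/-- The comparison `τ_d = ⟨d, F₁⟩ : A₁ ⟶ A₀ ×_{F₀,d} B₁`. -/
noncomputable def tau (F : A ⟶ B) : A.X₁ ⟶ pullback F.F₀ B.d :=
  pullback.lift A.d F.F₁ F.comm_d.symm

/-- An internal functor is faithful if `∂(F)₀` is a monomorphism. -/
def IsFaithful (F : A ⟶ B) : Prop := Mono (partialMap F)

/-- An internal functor is full if `∂(F)₀` is a regular epimorphism
(considered only over regular categories). -/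
def IsFull (F : A ⟶ B) : Prop := IsRegularEpi (partialMap F)

/-- An internal functor is fully faithful if `∂(F)₀` is an isomorphism. -/
def IsFullyFaithful (F : A ⟶ B) : Prop := IsIso (partialMap F)

/-- An internal functor is essentially surjective if the composite
`A₀ ×_{F₀,d} B₁ ⟶ B₁ ⟶ B₀` of the second projection and `c` is a regular epimorphism
(considered only over regular categories). -/
def IsEssSurj (F : A ⟶ B) : Prop := IsRegularEpi (pullback.snd F.F₀ B.d ≫ B.c)

/-- An internal functor is a fibration if `τ_d` is a regular epimorphism
(considered only over regular categories). -/
def IsFibration (F : A ⟶ B) : Prop := IsRegularEpi (tau F)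

end

section

variable {C : Type u} [Category.{v} C] [HasFiniteLimits C] [HasZeroMorphisms C]

/-- The morphism `K_d(F) : Ker(d) ⟶ Ker(d)` induced by `F₁`. -/
noncomputable def kerMap {A B : InternalGroupoid C} (F : A ⟶ B) : kernel A.d ⟶ kernel B.d :=
  kernel.lift B.d (kernel.ι A.d ≫ F.F₁)
    (by rw [Category.assoc, F.comm_d, kernel.condition_assoc, zero_comp])

theorem kerMap_id (A : InternalGroupoid C) : kerMap (𝟙 A) = 𝟙 (kernel A.d) := by
  rw [← cancel_mono (kernel.ι A.d), kerMap, kernel.lift_ι, Category.id_comp]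
  exact Category.comp_id _

theorem kerMap_comp {A B D : InternalGroupoid C} (F : A ⟶ B) (G : B ⟶ D) :
    kerMap (F ≫ G) = kerMap F ≫ kerMap G := by
  rw [← cancel_mono (kernel.ι D.d), Category.assoc, kerMap, kerMap, kerMap, kernel.lift_ι,
    kernel.lift_ι, kernel.lift_ι_assoc, Category.assoc]
  rfl

/-- The normalization functor `Grpd(C) ⥤ Arr(C)`: it sends `A` to
`Ker(d) ⟶ A₁ ⟶ A₀` (inclusion followed by `c`), and `F` to `(K_d(F), F₀)`. -/
noncomputable def normalization : InternalGroupoid C ⥤ Arrow C where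
  obj A := Arrow.mk (kernel.ι A.d ≫ A.c)
  map {A B} F := Arrow.homMk (kerMap F) F.F₀
    (by simp only [kerMap, Arrow.mk_hom, kernel.lift_ι_assoc, Category.assoc, F.comm_c])
  map_id A := by
    apply Arrow.hom_ext
    · exact kerMap_id A
    · rfl
  map_comp F G := by
    apply Arrow.hom_ext
    · exact kerMap_comp F G
    · rfl

end

end InternalGroupoid

/-- Two morphisms with the same codomain are jointly strongly epimorphic if they are jointly
epimorphic and jointly left orthogonal to all monomorphisms. -/
structure JointlyStrongEpi {C : Type u} [Category.{v} C] {X Y Z : C} (f : X ⟶ Z) (g : Y ⟶ Z) :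
    Prop where
  jointly_epi : ∀ {T : C} (s t : Z ⟶ T), f ≫ s = f ≫ t → g ≫ s = g ≫ t → s = t
  exists_lift : ∀ {P Q : C} (n : P ⟶ Q) [Mono n] (x : X ⟶ P) (y : Y ⟶ P) (z : Z ⟶ Q),
    x ≫ n = f ≫ z → y ≫ n = g ≫ z → ∃ l : Z ⟶ P, f ≫ l = x ∧ g ≫ l = y ∧ l ≫ n = z

namespace ArrowMor

variable {C : Type u} [Category.{v} C] [HasPullbacks C] {a b : Arrow C}

/-- The comparison `∂(f,f₀)₀ = ⟨a, f⟩ : A ⟶ A₀ ×_{f₀,b} B` of a morphism `(f,f₀) : a ⟶ b`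
of `Arr(C)`; here `f` is `φ.left` and `f₀` is `φ.right`. -/
noncomputable def partialMap (φ : a ⟶ b) : a.left ⟶ pullback φ.right b.hom :=
  pullback.lift a.hom φ.left (Arrow.w φ).symm

/-- `(f,f₀)` is faithful if `∂(f,f₀)₀` is a monomorphism. -/
def IsFaithful (φ : a ⟶ b) : Prop := Mono (partialMap φ)

/-- `(f,f₀)` is fully faithful if `∂(f,f₀)₀` is an isomorphism. -/
def IsFullyFaithful (φ : a ⟶ b) : Prop := IsIso (partialMap φ)

/-- `(f,f₀)` is full if `∂(f,f₀)₀` is a regular epimorphism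
(considered only over regular categories). -/
def IsFull (φ : a ⟶ b) : Prop := IsRegularEpi (partialMap φ)

/-- `(f,f₀)` is essentially surjective if `f₀` and `b` are jointly strongly epimorphic. -/
def IsEssSurj {C : Type u} [Category.{v} C] {a b : Arrow C} (φ : a ⟶ b) : Prop :=
  JointlyStrongEpi φ.right b.hom

/-- `(f,f₀)` is a fibration if `f` is a regular epimorphism
(considered only over regular categories). -/
def IsFibration {C : Type u} [Category.{v} C] {a b : Arrow C} (φ : a ⟶ b) : Prop :=
  IsRegularEpi φ.left

end ArrowMor

/-- An object of the category `Pt_Y(C)` of points over `Y`: a split epimorphism with codomain `Y`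
together with a chosen section. -/
structure PointOver {C : Type u} [Category.{v} C] (Y : C) where
  /-- the total object -/
  X : C
  /-- the split epimorphism -/
  p : X ⟶ Y
  /-- the chosen section -/
  s : Y ⟶ X
  s_p : s ≫ p = 𝟙 Y

namespace PointOver

variable {C : Type u} [Category.{v} C]

/-- A morphism of points over `Y`. -/
@[ext]
structure Hom {Y : C} (P Q : PointOver Y) where
  /-- the underlying morphism -/
  hom : P.X ⟶ Q.X
  hom_p : hom ≫ Q.p = P.p
  s_hom : P.s ≫ hom = Q.s

/-- The category `Pt_Y(C)`. -/
instance (Y : C) : Category (PointOver Y) where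
  Hom := Hom
  id P := ⟨𝟙 _, Category.id_comp _, Category.comp_id _⟩
  comp f g := ⟨f.hom ≫ g.hom, by rw [Category.assoc, g.hom_p, f.hom_p],
    by rw [← Category.assoc, f.s_hom, g.s_hom]⟩
  id_comp _ := Hom.ext (Category.id_comp _)
  comp_id _ := Hom.ext (Category.comp_id _)
  assoc _ _ _ := Hom.ext (Category.assoc _ _ _)

/-- The section induced on the pullback of a point over `Z` along `w : Y ⟶ Z`. -/
noncomputable def pullSec [HasPullbacks C] {Y Z : C} (w : Y ⟶ Z) (P : PointOver Z) :
    Y ⟶ pullback P.p w :=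
  pullback.lift (w ≫ P.s) (𝟙 Y)
    (by rw [Category.assoc, P.s_p, Category.comp_id, Category.id_comp])

/-- The morphism `f ×_Z Y` induced between the pullbacks along `w : Y ⟶ Z`. -/
noncomputable def pullHom [HasPullbacks C] {Y Z : C} (w : Y ⟶ Z) {P Q : PointOver Z}
    (f : P ⟶ Q) : pullback P.p w ⟶ pullback Q.p w :=
  pullback.lift (pullback.fst P.p w ≫ f.hom) (pullback.snd P.p w)
    (by rw [Category.assoc, f.hom_p, pullback.condition])

theorem pullSec_pullHom [HasPullbacks C] {Y Z : C} (w : Y ⟶ Z) {P Q : PointOver Z}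
    (f : P ⟶ Q) : pullSec w P ≫ pullHom w f = pullSec w Q := by
  rw [pullSec, pullSec, pullHom]
  apply pullback.hom_ext
  · rw [Category.assoc, pullback.lift_fst, pullback.lift_fst_assoc, pullback.lift_fst,
      Category.assoc, f.s_hom]
  · rw [Category.assoc, pullback.lift_snd, pullback.lift_snd, pullback.lift_snd]

/-- The change-of-base functor `Pt_Z(C) ⥤ Pt_Y(C)` along `w : Y ⟶ Z`, given by pullback. -/
noncomputable def baseChange [HasPullbacks C] {Y Z : C} (w : Y ⟶ Z) :
    PointOver Z ⥤ PointOver Y where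
  obj P := ⟨pullback P.p w, pullback.snd P.p w, pullSec w P, pullback.lift_snd _ _ _⟩
  map f := ⟨pullHom w f, pullback.lift_snd _ _ _, pullSec_pullHom w f⟩
  map_id P := by
    apply Hom.ext
    apply pullback.hom_ext
    · exact (pullback.lift_fst _ _ _).trans
        ((Category.comp_id _).trans (Category.id_comp _).symm)
    · exact (pullback.lift_snd _ _ _).trans (Category.id_comp _).symm
  map_comp {P Q R} f g := by
    apply Hom.ext
    apply pullback.hom_ext
    · change pullHom w (f ≫ g) ≫ _ = (pullHom w f ≫ pullHom w g) ≫ _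
      rw [pullHom, pullHom, pullHom, Category.assoc, pullback.lift_fst, pullback.lift_fst,
        pullback.lift_fst_assoc, Category.assoc]
      rfl
    · change pullHom w (f ≫ g) ≫ _ = (pullHom w f ≫ pullHom w g) ≫ _
      rw [pullHom, pullHom, pullHom, Category.assoc, pullback.lift_snd, pullback.lift_snd,
        pullback.lift_snd]

end PointOver

/-- A finitely complete category is protomodular if all change-of-base functors of the fibration
of points reflect isomorphisms. -/
class Protomodular (C : Type u) [Category.{v} C] [HasFiniteLimits C] : Prop where
  reflects : ∀ {Y Z : C} (w : Y ⟶ Z), (PointOver.baseChange w).ReflectsIsomorphisms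

/-!
Everything happens over the object of objects `A₀`. The map `d : A₁ ⟶ A₀` is split by the
identities, and both comparison maps `⟨d, F₁, c⟩` and `⟨d, F₁⟩` are morphisms of points from
`(A₁, d, e)` to the first projection of their codomain. The kernel of that projection is
`A₀ ×_{F₀,b} Ker(d)` in the first case and `Ker(d)` in the second, and the morphism induced
between the kernels is respectively the comparison map of `N(F)` and `K_d(F)`. Such a restriction
to kernels is a pullback (`isPullback_of_isKernel`), so monomorphisms, isomorphisms and, over a
regular category, regular epimorphisms pass from `F` to `N(F)`.

For the converse, protomodularity says that the kernel and the section of a split epimorphism do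
not both factor through a proper subobject (`Protomodular.isIso_of_mono`). Applied to the diagonal
of a kernel pair, to the comparison map itself, and to its regular image, this reflects
monomorphisms, isomorphisms and regular epimorphisms respectively.

For essential surjectivity, the first projection of `P = A₀ ×_{F₀,d} B₁` is split, with kernel
`Ker(d)`; composing `r : P ⟶ B₁ ⟶ B₀` with the section gives `F₀`, and with the kernel gives `b`.
So a subobject of `B₀` through which `r` factors contains `F₀` and `b`, and the converse holds in
the protomodular case.
-/

/-! ### Restriction to kernels -/

section Kernels

variable {C : Type u} [Category.{v} C] [HasZeroMorphisms C]

theorem isPullback_of_isKernel {K L X Z Y : C} {k : K ⟶ X} {l : L ⟶ Z} {φ : X ⟶ Z} {q : Z ⟶ Y}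
    {u : K ⟶ L} {wk : k ≫ φ ≫ q = 0} {wl : l ≫ q = 0} (hk : IsLimit (KernelFork.ofι k wk))
    (hl : IsLimit (KernelFork.ofι l wl)) (comm : k ≫ φ = u ≫ l) : IsPullback k u φ l := by
  have hk' : Mono k := mono_of_isLimit_fork hk
  have hl' : Mono l := mono_of_isLimit_fork hl
  have lift (s : PullbackCone φ l) : ∃ t : s.pt ⟶ K, t ≫ k = s.fst := by
    have h : s.fst ≫ φ ≫ q = 0 := by
      rw [← Category.assoc, s.condition, Category.assoc, wl, comp_zero]
    exact ⟨_, (KernelFork.IsLimit.lift' hk s.fst h).2⟩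
  choose t ht using lift
  refine ⟨⟨comm⟩, ⟨PullbackCone.IsLimit.mk _ t ht (fun s => ?_) (fun s m hm _ => ?_)⟩⟩
  · rw [← cancel_mono l, Category.assoc, ← comm, ← s.condition, reassoc_of% (ht s)]
  · rw [← cancel_mono k, hm, ht]

end Kernels

/-! ### Points in a protomodular category -/

section Protomodular

variable {C : Type u} [Category.{v} C] [HasFiniteLimits C] [HasZeroMorphisms C] [HasZeroObject C]
  [Protomodular C]

open ZeroObject in
/-- In a protomodular category the kernel and the section of a split epimorphism are jointly
extremal: a subobject containing both is everything. -/
theorem Protomodular.isIso_of_mono {X Y L M : C} {q : X ⟶ Y} {s : Y ⟶ X} (hs : s ≫ q = 𝟙 Y)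
    {l : L ⟶ X} {wl : l ≫ q = 0} (hl : IsLimit (KernelFork.ofι l wl)) (n : M ⟶ X) [Mono n]
    (hsn : ∃ s' : Y ⟶ M, s' ≫ n = s) (hln : ∃ l' : L ⟶ M, l' ≫ n = l) : IsIso n := by
  obtain ⟨s', hs'⟩ := hsn
  obtain ⟨l', hl'⟩ := hln
  let P : PointOver Y := ⟨M, n ≫ q, s', by rw [← Category.assoc, hs', hs]⟩
  let Q : PointOver Y := ⟨X, q, s, hs⟩
  let f : P ⟶ Q := ⟨n, rfl, hs'⟩
  let w : (0 : C) ⟶ Y := 0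
  -- The inverse of the base change of `n` along `0 ⟶ Y` comes from the factorization of `l`.
  obtain ⟨t, ht⟩ := KernelFork.IsLimit.lift' hl (pullback.fst Q.p w)
    (pullback.condition.trans comp_zero)
  have ht : t ≫ l = pullback.fst Q.p w := ht
  let g : pullback Q.p w ⟶ pullback P.p w := pullback.lift (t ≫ l') (pullback.snd Q.p w) (by
    change (t ≫ l') ≫ n ≫ q = _
    rw [Category.assoc, reassoc_of% hl', reassoc_of% ht]
    exact pullback.condition)
  have hgf : g ≫ PointOver.pullHom w f = 𝟙 _ := by
    apply pullback.hom_ext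
    · rw [PointOver.pullHom, Category.assoc, pullback.lift_fst, pullback.lift_fst_assoc,
        Category.id_comp]
      change (t ≫ l') ≫ n = _
      rw [Category.assoc, hl', ht]
    · rw [PointOver.pullHom, Category.assoc, pullback.lift_snd, pullback.lift_snd,
        Category.id_comp]
  have hfg : PointOver.pullHom w f ≫ g = 𝟙 _ := by
    apply pullback.hom_ext
    · rw [← cancel_mono n]
      have h := congrArg (· ≫ pullback.fst Q.p w) hgf
      have h1 : g ≫ pullback.fst P.p w ≫ n = pullback.fst Q.p w := by
        rw [pullback.lift_fst_assoc, Category.assoc, hl', ht]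
      rw [Category.assoc, Category.assoc, h1, PointOver.pullHom, pullback.lift_fst,
        Category.id_comp]
    · exact (isZero_zero C).eq_of_tgt _ _
  have hinv : IsIso ((PointOver.baseChange w).map f) := by
    refine ⟨⟨g, ?_, ?_⟩, PointOver.Hom.ext hfg, PointOver.Hom.ext hgf⟩
    · exact pullback.lift_snd _ _ _
    · change PointOver.pullSec w Q ≫ g = PointOver.pullSec w P
      rw [← PointOver.pullSec_pullHom w f, Category.assoc, hfg, Category.comp_id]
  have := Protomodular.reflects w
  have hf : IsIso f := isIso_of_reflects_iso f (PointOver.baseChange w)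
  exact ⟨(inv f).hom, congrArg PointOver.Hom.hom (IsIso.hom_inv_id f),
    congrArg PointOver.Hom.hom (IsIso.inv_hom_id f)⟩

variable {X Y Z K L : C} {φ : X ⟶ Z} {q : Z ⟶ Y} {s : Y ⟶ X} {k : K ⟶ X} {l : L ⟶ Z}
  {u : K ⟶ L} {wk : k ≫ φ ≫ q = 0} {wl : l ≫ q = 0}

/-- A morphism of points whose restriction to the kernel is monic is monic: the diagonal
of the kernel pair of `φ` contains the section and the kernel of the kernel pair over `Y`. -/
theorem Protomodular.mono_of_mono_kernel (hs : s ≫ φ ≫ q = 𝟙 Y)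
    (hk : IsLimit (KernelFork.ofι k wk)) [Mono (k ≫ φ)] : Mono φ := by
  let Δ := pullback.diagonal φ
  let p := pullback.fst φ φ ≫ φ ≫ q
  -- On the kernel the two projections agree.
  have key : kernel.ι p ≫ pullback.fst φ φ = kernel.ι p ≫ pullback.snd φ φ := by
    obtain ⟨a, ha⟩ := KernelFork.IsLimit.lift' hk (kernel.ι p ≫ pullback.fst φ φ)
      (by rw [Category.assoc]; exact kernel.condition p)
    obtain ⟨b, hb⟩ := KernelFork.IsLimit.lift' hk (kernel.ι p ≫ pullback.snd φ φ)
      (by rw [Category.assoc, ← pullback.condition_assoc]; exact kernel.condition p)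
    have ha : a ≫ k = _ := ha
    have hb : b ≫ k = _ := hb
    have hab : a = b := by
      rw [← cancel_mono (k ≫ φ), reassoc_of% ha, reassoc_of% hb, pullback.condition]
    rw [← ha, ← hb, hab]
  have hΔ : IsIso Δ := Protomodular.isIso_of_mono (q := p) (s := s ≫ Δ) (by
      simp only [Δ, p, Category.assoc, pullback.diagonal_fst_assoc, hs])
    (wl := kernel.condition p) (kernelIsKernel p) Δ ⟨s, rfl⟩ ⟨kernel.ι p ≫ pullback.fst φ φ, by
      apply pullback.hom_ext
      · simp [Δ]
      · simp [Δ, key]⟩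
  refine ⟨fun a b h => ?_⟩
  have h1 : pullback.fst φ φ = pullback.snd φ φ := by
    rw [← cancel_epi Δ, pullback.diagonal_fst, pullback.diagonal_snd]
  rw [← pullback.lift_fst a b h, h1, pullback.lift_snd]

theorem Protomodular.isIso_of_isIso_kernel (hs : s ≫ φ ≫ q = 𝟙 Y)
    (hk : IsLimit (KernelFork.ofι k wk)) (hl : IsLimit (KernelFork.ofι l wl))
    (comm : k ≫ φ = u ≫ l) [IsIso u] : IsIso φ := by
  have : Mono l := mono_of_isLimit_fork hl
  have : Mono (k ≫ φ) := by rw [comm]; infer_instance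
  have : Mono φ := Protomodular.mono_of_mono_kernel hs hk
  exact Protomodular.isIso_of_mono (s := s ≫ φ) (by rw [Category.assoc, hs]) hl φ ⟨s, rfl⟩
    ⟨inv u ≫ k, by rw [Category.assoc, comm, IsIso.inv_hom_id_assoc]⟩

/-- The morphism induced on kernels by a morphism of points reflects regular epimorphisms: the
image of `φ` contains the section, and it contains the kernel `l` because `u ≫ l` factors through
it and `u` is a strong epimorphism. -/
theorem Protomodular.isRegularEpi_of_isRegularEpi_kernel (_ : Regular C) (hs : s ≫ φ ≫ q = 𝟙 Y)
    (hl : IsLimit (KernelFork.ofι l wl)) (comm : k ≫ φ = u ≫ l) [IsRegularEpi u] :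
    IsRegularEpi φ := by
  let S := Regular.strongEpiMonoFactorisation φ
  have hS : S.e ≫ S.m = φ := S.fac
  have sq : CommSq (k ≫ S.e) u S.m l := ⟨by rw [Category.assoc, hS, comm]⟩
  have : IsIso S.m := Protomodular.isIso_of_mono (s := s ≫ φ) (by rw [Category.assoc, hs]) hl S.m
    ⟨s ≫ S.e, by rw [Category.assoc, hS]⟩ ⟨sq.lift, sq.fac_right⟩
  have : StrongEpi φ := by rw [← hS]; exact strongEpi_comp _ _
  infer_instance

end Protomodular

/-! ### The kernels of the comparison maps -/

namespace InternalGroupoid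

section

variable {C : Type u} [Category.{v} C] [HasPullbacks C] {A B : InternalGroupoid C} (F : A ⟶ B)

theorem tau_fst : tau F ≫ pullback.fst F.F₀ B.d = A.d := pullback.lift_fst _ _ _

theorem tau_snd : tau F ≫ pullback.snd F.F₀ B.d = F.F₁ := pullback.lift_snd _ _ _

theorem partialMap_fst : partialMap F ≫ pullback.fst _ _ = tau F := pullback.lift_fst _ _ _

theorem partialMap_snd : partialMap F ≫ pullback.snd _ _ = A.c := pullback.lift_snd _ _ _

theorem partialMap_fst_fst :
    partialMap F ≫ pullback.fst _ _ ≫ pullback.fst F.F₀ B.d = A.d := by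
  rw [← Category.assoc, partialMap_fst, tau_fst]

/-- The section `y ↦ (y, 1)` of the first projection of `A₀ ×_{F₀,d} B₁`. -/
noncomputable def tauSec : A.X₀ ⟶ pullback F.F₀ B.d :=
  pullback.lift (𝟙 _) (F.F₀ ≫ B.e) (by
    rw [Category.assoc, B.e_d, Category.comp_id, Category.id_comp])

theorem tauSec_snd_c : tauSec F ≫ pullback.snd F.F₀ B.d ≫ B.c = F.F₀ := by
  rw [tauSec, pullback.lift_snd_assoc, Category.assoc, B.e_c, Category.comp_id]

end

variable {C : Type u} [Category.{v} C] [HasFiniteLimits C] [HasZeroMorphisms C]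
  {A B : InternalGroupoid C} (F : A ⟶ B)

/-- The inclusion `g ↦ (0, g)` of `Ker(d)` in `A₀ ×_{F₀,d} B₁`. -/
noncomputable def tauKer : kernel B.d ⟶ pullback F.F₀ B.d :=
  pullback.lift 0 (kernel.ι B.d) (by rw [zero_comp, kernel.condition])

theorem tauKer_fst : tauKer F ≫ pullback.fst F.F₀ B.d = 0 := pullback.lift_fst _ _ _

theorem tauKer_snd : tauKer F ≫ pullback.snd F.F₀ B.d = kernel.ι B.d := pullback.lift_snd _ _ _

/-- `Ker(d)` is the kernel of the first projection of `A₀ ×_{F₀,d} B₁`. -/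
noncomputable def isLimitTauKer : IsLimit (KernelFork.ofι (tauKer F) (tauKer_fst F)) :=
  KernelFork.IsLimit.ofι _ _
    (fun t ht => kernel.lift B.d (t ≫ pullback.snd _ _) (by
      rw [Category.assoc, ← pullback.condition, reassoc_of% ht, zero_comp]))
    (fun t ht => by
      apply pullback.hom_ext
      · rw [Category.assoc, tauKer_fst, comp_zero, ht]
      · rw [Category.assoc, tauKer_snd, kernel.lift_ι])
    (fun t ht m hm => by
      rw [← cancel_mono (kernel.ι B.d), kernel.lift_ι, ← hm, Category.assoc, tauKer_snd])

/-- The inclusion `(y, g) ↦ (0, g, y)` of `A₀ ×_{F₀,b} Ker(d)` in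
`A₀ ×_{F₀,d} B₁ ×_{c,F₀} A₀`. -/
noncomputable def partialKer : pullback F.F₀ (kernel.ι B.d ≫ B.c) ⟶ homObj F :=
  pullback.lift (pullback.snd _ _ ≫ tauKer F) (pullback.fst _ _) (by
    rw [Category.assoc, reassoc_of% (tauKer_snd F), pullback.condition])

theorem partialKer_fst :
    partialKer F ≫ pullback.fst _ _ = pullback.snd _ _ ≫ tauKer F := pullback.lift_fst _ _ _

theorem partialKer_snd : partialKer F ≫ pullback.snd _ _ = pullback.fst _ _ :=
  pullback.lift_snd _ _ _

theorem partialKer_condition :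
    partialKer F ≫ pullback.fst _ _ ≫ pullback.fst F.F₀ B.d = 0 := by
  rw [reassoc_of% (partialKer_fst F), tauKer_fst, comp_zero]

/-- `A₀ ×_{F₀,b} Ker(d)` is the kernel of the first projection of
`A₀ ×_{F₀,d} B₁ ×_{c,F₀} A₀`. -/
noncomputable def isLimitPartialKer :
    IsLimit (KernelFork.ofι (partialKer F) (partialKer_condition F)) :=
  KernelFork.IsLimit.ofι _ _
    (fun t ht => pullback.lift (t ≫ pullback.snd _ _)
      (kernel.lift B.d (t ≫ pullback.fst _ _ ≫ pullback.snd _ _) (by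
        rw [Category.assoc, Category.assoc, ← pullback.condition, ← Category.assoc,
          ← Category.assoc, Category.assoc t, ht, zero_comp]))
      (by rw [kernel.lift_ι_assoc, Category.assoc, Category.assoc, ← pullback.condition,
        Category.assoc]))
    (fun t ht => by
      apply pullback.hom_ext
      · apply pullback.hom_ext
        · rw [Category.assoc, Category.assoc, partialKer_condition, comp_zero, Category.assoc, ht]
        · rw [Category.assoc, Category.assoc, reassoc_of% (partialKer_fst F), tauKer_snd,
            pullback.lift_snd_assoc, kernel.lift_ι, Category.assoc]
      · rw [Category.assoc, partialKer_snd, pullback.lift_fst])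
    (fun t ht m hm => by
      apply pullback.hom_ext
      · rw [pullback.lift_fst, ← hm, Category.assoc, partialKer_snd]
      · rw [pullback.lift_snd, ← cancel_mono (kernel.ι B.d), kernel.lift_ι, ← hm, Category.assoc,
          Category.assoc, reassoc_of% (partialKer_fst F), tauKer_snd])

theorem ι_tau : kernel.ι A.d ≫ tau F = kerMap F ≫ tauKer F := by
  apply pullback.hom_ext
  · rw [Category.assoc, Category.assoc, tau_fst, tauKer_fst, kernel.condition, comp_zero]
  · rw [Category.assoc, Category.assoc, tau_snd, tauKer_snd, kerMap, kernel.lift_ι]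

/-- The comparison map of `N(F)`, with its domain and codomain unfolded. -/
noncomputable def normalizationPartialMap :
    kernel A.d ⟶ pullback F.F₀ (kernel.ι B.d ≫ B.c) :=
  pullback.lift (kernel.ι A.d ≫ A.c) (kerMap F) (by
    rw [kerMap, kernel.lift_ι_assoc, Category.assoc, Category.assoc, F.comm_c])

theorem partialMap_normalization :
    ArrowMor.partialMap (normalization.map F) = normalizationPartialMap F := rfl

theorem ι_partialMap :
    kernel.ι A.d ≫ partialMap F = normalizationPartialMap F ≫ partialKer F := by
  apply pullback.hom_ext
  · rw [Category.assoc, partialMap_fst, ι_tau, Category.assoc, partialKer_fst,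
      normalizationPartialMap, pullback.lift_snd_assoc]
  · rw [Category.assoc, partialMap_snd, Category.assoc, partialKer_snd,
      normalizationPartialMap, pullback.lift_fst]

/-- A kernel inclusion is still one when the morphism is written as a composite. -/
noncomputable def isLimitKernelι {X Y Z : C} {f : X ⟶ Y} {φ : X ⟶ Z} {q : Z ⟶ Y}
    (h : φ ≫ q = f) :
    IsLimit (KernelFork.ofι (f := φ ≫ q) (kernel.ι f) (by rw [h, kernel.condition])) := by
  subst h
  exact kernelIsKernel _

theorem isPullback_tau : IsPullback (kernel.ι A.d) (kerMap F) (tau F) (tauKer F) :=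
  isPullback_of_isKernel (isLimitKernelι (tau_fst F)) (isLimitTauKer F) (ι_tau F)

theorem isPullback_partialMap : IsPullback (kernel.ι A.d) (normalizationPartialMap F)
    (partialMap F) (partialKer F) :=
  isPullback_of_isKernel (isLimitKernelι (partialMap_fst_fst F)) (isLimitPartialKer F)
    (ι_partialMap F)

/-! ### Essential surjectivity -/

theorem tauKer_snd_c : tauKer F ≫ pullback.snd F.F₀ B.d ≫ B.c = kernel.ι B.d ≫ B.c := by
  rw [← Category.assoc, tauKer_snd]

theorem jointlyStrongEpi_of_isEssSurj [HasZeroObject C] [Protomodular C] (hF : IsEssSurj F) :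
    JointlyStrongEpi F.F₀ (kernel.ι B.d ≫ B.c) := by
  have hr : IsRegularEpi (pullback.snd F.F₀ B.d ≫ B.c) := hF
  have ext : ∀ {M : C} (n : M ⟶ B.X₀) [Mono n], (∃ x, x ≫ n = F.F₀) →
      (∃ y, y ≫ n = kernel.ι B.d ≫ B.c) → IsIso n := by
    rintro M n hn ⟨x, hx⟩ ⟨y, hy⟩
    -- The inverse image of `n` along `r` contains the section and the kernel.
    let r := pullback.snd F.F₀ B.d ≫ B.c
    have : IsIso (pullback.fst r n) := Protomodular.isIso_of_mono (s := tauSec F)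
      (pullback.lift_fst _ _ _) (isLimitTauKer F) _
      ⟨pullback.lift (tauSec F) x ((tauSec_snd_c F).trans hx.symm), pullback.lift_fst _ _ _⟩
      ⟨pullback.lift (tauKer F) y ((tauKer_snd_c F).trans hy.symm), pullback.lift_fst _ _ _⟩
    exact ExtremalEpi.isIso r (inv (pullback.fst r n) ≫ pullback.snd r n) n (by
      rw [Category.assoc, ← pullback.condition, IsIso.inv_hom_id_assoc])
  refine ⟨fun s t h₁ h₂ => ?_, fun n _ x y z hx hy => ?_⟩
  · have := ext (equalizer.ι s t) ⟨_, equalizer.lift_ι _ h₁⟩ ⟨_, equalizer.lift_ι _ h₂⟩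
    rw [← cancel_epi (equalizer.ι s t), equalizer.condition]
  · have := ext (pullback.snd n z) ⟨_, pullback.lift_snd _ _ hx⟩ ⟨_, pullback.lift_snd _ _ hy⟩
    have hl : (inv (pullback.snd n z) ≫ pullback.fst n z) ≫ n = z := by
      rw [Category.assoc, pullback.condition, IsIso.inv_hom_id_assoc]
    refine ⟨inv (pullback.snd n z) ≫ pullback.fst n z, ?_, ?_, hl⟩
    · rw [← cancel_mono n, hx, Category.assoc, hl]
    · rw [← cancel_mono n, hy, Category.assoc _ _ n, hl]

theorem isEssSurj_of_jointlyStrongEpi (_ : Regular C)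
    (h : JointlyStrongEpi F.F₀ (kernel.ι B.d ≫ B.c)) : IsEssSurj F := by
  -- The image of `r` contains `F₀` and `b`, hence is everything.
  let S := Regular.strongEpiMonoFactorisation (pullback.snd F.F₀ B.d ≫ B.c)
  have hS : S.e ≫ S.m = pullback.snd F.F₀ B.d ≫ B.c := S.fac
  obtain ⟨l, -, -, hl⟩ := h.exists_lift S.m (tauSec F ≫ S.e) (tauKer F ≫ S.e) (𝟙 _)
    (by rw [Category.assoc, hS, tauSec_snd_c, Category.comp_id])
    (by rw [Category.assoc, hS, tauKer_snd_c, Category.comp_id])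
  have : IsIso S.m := ⟨l, by rw [← cancel_mono S.m, Category.assoc, hl, Category.comp_id,
    Category.id_comp], hl⟩
  have : StrongEpi (pullback.snd F.F₀ B.d ≫ B.c) := by rw [← hS]; exact strongEpi_comp _ _
  exact Regular.isRegularEpi_of_extremalEpi _

end InternalGroupoid

/-! ### Comparison of `F` and `N(F)` -/

theorem mainTheorem4 {C : Type u} [Category.{v} C] [HasFiniteLimits C] [HasZeroMorphisms C]
    [HasZeroObject C] {A B : InternalGroupoid C} (F : A ⟶ B) :
    (InternalGroupoid.IsFaithful F →
      ArrowMor.IsFaithful (InternalGroupoid.normalization.map F)) ∧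
    (InternalGroupoid.IsFullyFaithful F →
      ArrowMor.IsFullyFaithful (InternalGroupoid.normalization.map F)) ∧
    (Regular C → InternalGroupoid.IsFull F →
      ArrowMor.IsFull (InternalGroupoid.normalization.map F)) ∧
    (Protomodular C → ArrowMor.IsFaithful (InternalGroupoid.normalization.map F) →
      InternalGroupoid.IsFaithful F) ∧
    (Protomodular C → ArrowMor.IsFullyFaithful (InternalGroupoid.normalization.map F) →
      InternalGroupoid.IsFullyFaithful F) ∧
    (Regular C → Protomodular C → ArrowMor.IsFull (InternalGroupoid.normalization.map F) →
      InternalGroupoid.IsFull F) ∧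
    (Regular C → Protomodular C → InternalGroupoid.IsEssSurj F →
      ArrowMor.IsEssSurj (InternalGroupoid.normalization.map F)) ∧
    (Regular C → ArrowMor.IsEssSurj (InternalGroupoid.normalization.map F) →
      InternalGroupoid.IsEssSurj F) ∧
    (Regular C → InternalGroupoid.IsFibration F →
      ArrowMor.IsFibration (InternalGroupoid.normalization.map F)) ∧
    (Regular C → Protomodular C →
      ArrowMor.IsFibration (InternalGroupoid.normalization.map F) →
      InternalGroupoid.IsFibration F) := by
  have hs : A.e ≫ InternalGroupoid.partialMap F ≫ pullback.fst _ _ ≫ pullback.fst F.F₀ B.d =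
      𝟙 _ := by rw [InternalGroupoid.partialMap_fst_fst, A.e_d]
  have hs' : A.e ≫ InternalGroupoid.tau F ≫ pullback.fst F.F₀ B.d = 𝟙 _ := by
    rw [InternalGroupoid.tau_fst, A.e_d]
  have hp := InternalGroupoid.isPullback_partialMap F
  have ht := InternalGroupoid.isPullback_tau F
  have hk := InternalGroupoid.isLimitKernelι (InternalGroupoid.partialMap_fst_fst F)
  have hl := InternalGroupoid.isLimitPartialKer F
  simp only [ArrowMor.IsFaithful, ArrowMor.IsFullyFaithful, ArrowMor.IsFull,
    InternalGroupoid.partialMap_normalization]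
  refine ⟨fun h => ?_, fun h => ?_, fun hR h => ?_, fun hP h => ?_, fun hP h => ?_,
    fun hR hP h => ?_, fun hR hP h => ?_, fun hR h => ?_, fun hR h => ?_, fun hR hP h => ?_⟩
  · exact MorphismProperty.of_isPullback (P := .monomorphisms C) hp h
  · exact MorphismProperty.of_isPullback (P := .isomorphisms C) hp h
  · exact Regular.regularEpiIsStableUnderBaseChange.of_isPullback hp h
  · have : Mono (InternalGroupoid.normalizationPartialMap F) := h
    have : Mono (InternalGroupoid.partialKer F) := mono_of_isLimit_fork hl
    have : Mono (kernel.ι A.d ≫ InternalGroupoid.partialMap F) := by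
      rw [hp.w]; infer_instance
    exact Protomodular.mono_of_mono_kernel hs hk
  · have : IsIso (InternalGroupoid.normalizationPartialMap F) := h
    exact Protomodular.isIso_of_isIso_kernel hs hk hl hp.w
  · have : IsRegularEpi (InternalGroupoid.normalizationPartialMap F) := h
    exact Protomodular.isRegularEpi_of_isRegularEpi_kernel hR hs hl hp.w
  · exact InternalGroupoid.jointlyStrongEpi_of_isEssSurj F h
  · exact InternalGroupoid.isEssSurj_of_jointlyStrongEpi F hR h
  · exact Regular.regularEpiIsStableUnderBaseChange.of_isPullback ht h
  · have : IsRegularEpi (InternalGroupoid.kerMap F) := h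
    exact Protomodular.isRegularEpi_of_isRegularEpi_kernel hR hs'
      (InternalGroupoid.isLimitTauKer F) ht.w
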